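/- All graphs are finite and simple. A graph $G$ is perfect if $\chi(G')=\omega(G')$ for every induced subgraph $G'$ of $G$; it is minimal imperfect if it is not perfect but all its proper induced subgraphs are. For cliques $K_1,K_2$ of $G$, an induced path of $G$ (possibly of length $0$) is external if it has one end-vertex in $K_1$, the other in $K_2$, and no other vertex in $K_1\cup K_2$; $\{K_1,K_2\}$ is an odd pair of cliques if every external induced path has odd length (in particular $K_1\cap K_2=\emptyset$). Let $G_{K_1\equiv K_2}$ be the graph obtained from $G$ by adding all missing edges between $K_1$ and $K_2$. For integers $p,q\ge 1$, a graph $H$ is $(p,q)$-partitionable if for every vertex $v$ the vertex set of $H\setminus v$ can be partitioned into $p$ cliques of size $q$ and also into $q$ stable sets of size $p$. Let $G$ be a minimal imperfect graph with clique number $\omega=\omega(G)$ and stability number $\alpha=\alpha(G)$, and let $\{K_1,K_2\}$ be an odd pair of cliques of $G$ with $|K_1|+|K_2|<\omega$. Then: 1. every clique of size $\omega$ of $G_{K_1\equiv K_2}$ is a clique of $G$; 2. every stable set of size $\alpha$ of $G$ is a stable set of $G_{K_1\equiv K_2}$; 3. $G_{K_1\equiv K_2}$ is $(\alpha,\omega)$-partitionable.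 -/

import Mathlib

namespace SimpleGraph

/-- A graph is perfect if every induced subgraph has chromatic number equal to its clique number. -/
def IsPerfect {V : Type*} (G : SimpleGraph V) : Prop :=
  ∀ s : Set V, (G.induce s).chromaticNumber = ((G.induce s).cliqueNum : ℕ∞)

/-- A graph is minimal imperfect if it is not perfect but all its proper induced subgraphs are. -/
def IsMinimalImperfect {V : Type*} (G : SimpleGraph V) : Prop :=
  ¬ G.IsPerfect ∧ ∀ s : Set V, s ≠ Set.univ → (G.induce s).IsPerfect

/-- A path that is external from `K₁` to `K₂`: it is an induced (chordless) path with one end-vertex in `K₁`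
and the other in `K₂`, and its remaining vertices (if any) lie outside `K₁ ∪ K₂`. -/
def Walk.IsExternal {V : Type*} {G : SimpleGraph V} {u w : V} (P : G.Walk u w)
    (K₁ K₂ : Finset V) : Prop :=
  P.IsPath ∧ P.IsChordless ∧ u ∈ K₁ ∧ w ∈ K₂ ∧
    ∀ x ∈ P.support, x ≠ u → x ≠ w → x ∉ K₁ ∧ x ∉ K₂

/-- `{K₁, K₂}` is an odd pair of cliques of `G`. (Disjointness is automatic: a common vertex
would be an external path of length `0`.) -/
def IsOddPairOfCliques {V : Type*} (G : SimpleGraph V) (K₁ K₂ : Finset V) : Prop :=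
  G.IsClique (K₁ : Set V) ∧ G.IsClique (K₂ : Set V) ∧
    ∀ (u w : V) (P : G.Walk u w), P.IsExternal K₁ K₂ → Odd P.length

/-- The graph obtained from `G` by joining every vertex of `K₁` to every vertex of `K₂`. -/
def joinCliques {V : Type*} (G : SimpleGraph V) (K₁ K₂ : Finset V) : SimpleGraph V :=
  G ⊔ SimpleGraph.fromRel fun x y => x ∈ K₁ ∧ y ∈ K₂

/-- `G` is `(p, q)`-partitionable, `p, q ≥ 1`: for every vertex `v`, the vertices other than `v`
can be partitioned into `p` cliques of size `q`, and also into `q` stable sets of size `p`. -/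
def IsPartitionable {V : Type*} [Fintype V] [DecidableEq V] (G : SimpleGraph V) (p q : ℕ) : Prop :=
  1 ≤ p ∧ 1 ≤ q ∧ ∀ v : V,
    (∃ 𝒦 : Finpartition (Finset.univ.erase v),
      𝒦.parts.card = p ∧ ∀ K ∈ 𝒦.parts, G.IsNClique q K) ∧
    (∃ 𝒮 : Finpartition (Finset.univ.erase v),
      𝒮.parts.card = q ∧ ∀ S ∈ 𝒮.parts, G.IsNIndepSet p S)

end SimpleGraph

/-! Write `J` for the all-ones matrix, `ω` and `α` for the clique and stability numbers. In a
minimal imperfect graph, every stable set misses some maximum clique. Applied to a maximum stable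
set `S` and to the colour classes of `ω`-colourings of `G - s`, `s ∈ S`, this gives `αω + 1` stable
sets `A i` and maximum cliques `B i` with `|A i ∩ B j|` equal to `0` if `i = j` and to `1`
otherwise. Since `J - I` is invertible, `|V| = αω + 1`, and the matrix identity transposes: the `A
i` with `v ∈ B i` partition `V - v`, and dually. So `G` is partitionable, and the join inherits this
once claim 2 is known.

Claim 1: a large clique of the join has a vertex `v` outside both `K₁` and `K₂`; a missing edge `ab`
would give the external path `a v b` of length 2.

Claim 2: let `A i` contain `a ∈ K₁` and `b ∈ K₂`. Counting gives `A j` disjoint from `A i`, `K₁` and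
`K₂`. By parity, `a` and `b` lie in different components of the bipartite graph on `A i ∪ A j`.
Exchanging the two sets on the component of `a` gives two maximum stable sets, one of which misses
`B i` and so equals `A i` (`eq_left_of_disjoint`), although neither contains both `a` and `b`. -/

section SetSystem

/-! ### Invertibility of `J - I` and its consequences -/

open Finset Matrix

variable {V : Type*} [Fintype V] [DecidableEq V]

/-- The matrix with zero diagonal and all other entries equal to one. -/
def offDiagOnes (ι : Type*) [DecidableEq ι] : Matrix ι ι ℚ :=
  Matrix.of fun i j => if i = j then 0 else 1

theorem offDiagOnes_eq (ι : Type*) [DecidableEq ι] :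
    offDiagOnes ι = Matrix.of (fun _ _ => (1 : ℚ)) - 1 := by
  ext i j
  by_cases h : i = j <;> simp [offDiagOnes, h]

theorem isUnit_offDiagOnes {ι : Type*} [Fintype ι] [DecidableEq ι] (h : 2 ≤ Fintype.card ι) :
    IsUnit (offDiagOnes ι) := by
  rw [← Matrix.mulVec_injective_iff_isUnit]
  rw [← Matrix.coe_mulVecLin, ← LinearMap.ker_eq_bot, LinearMap.ker_eq_bot']
  intro x hx
  have hx' : ∀ i, ∑ j, x j = x i := by
    intro i
    have := congrFun hx i
    rw [Matrix.mulVecLin_apply, offDiagOnes_eq, Matrix.sub_mulVec, Matrix.one_mulVec] at this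
    simp only [Pi.sub_apply, Pi.zero_apply, Matrix.mulVec, dotProduct, Matrix.of_apply,
      one_mul] at this
    linarith
  have hs : ∑ i, ∑ j, x j = ∑ i, x i := Finset.sum_congr rfl fun i _ => hx' i
  simp only [Finset.sum_const, Finset.card_univ, nsmul_eq_mul] at hs
  have h2 : (2 : ℚ) ≤ Fintype.card ι := by exact_mod_cast h
  have h0 : ∑ j, x j = 0 := by
    have : ((Fintype.card ι : ℚ) - 1) * ∑ j, x j = 0 := by linarith
    rcases mul_eq_zero.1 this with h' | h'
    · linarith
    · exact h'
  ext i
  rw [← hx' i, h0]; rfl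

/-- Both factors are invertible. From `J A N = J (J - I) = αω J = α J N`, cancelling `N` gives `J A
= α J`; then `A (N A) = J A - A = A (J - I)`, and `A` cancels. -/
theorem mul_comm_of_mul_eq_offDiagOnes {A N : Matrix V V ℚ} {α ω : ℚ}
    (hcard : (Fintype.card V : ℚ) = α * ω + 1) (h2 : 2 ≤ Fintype.card V)
    (hA : A * Matrix.of (fun _ _ => (1 : ℚ)) = α • Matrix.of (fun _ _ => (1 : ℚ)))
    (hN : Matrix.of (fun _ _ => (1 : ℚ)) * N = ω • Matrix.of (fun _ _ => (1 : ℚ)))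
    (h : A * N = offDiagOnes V) :
    N * A = offDiagOnes V ∧
      Matrix.of (fun _ _ => (1 : ℚ)) * A = α • Matrix.of (fun _ _ => (1 : ℚ)) := by
  have hu := isUnit_offDiagOnes h2
  rw [offDiagOnes_eq] at *
  set J : Matrix V V ℚ := Matrix.of (fun _ _ => (1 : ℚ)) with hJ
  rw [← h] at hu
  have hdet : IsUnit (A.det * N.det) := by
    rw [← Matrix.det_mul]; exact (Matrix.isUnit_iff_isUnit_det _).1 hu
  have huA : IsUnit A := (Matrix.isUnit_iff_isUnit_det _).2 (isUnit_of_mul_isUnit_left hdet)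
  have huN : IsUnit N := (Matrix.isUnit_iff_isUnit_det _).2 (isUnit_of_mul_isUnit_right hdet)
  have hJJ : J * J = (α * ω + 1) • J := by
    ext i j
    simp [hJ, Matrix.mul_apply, hcard]
  have hJA : J * A = α • J := by
    apply huN.mul_right_cancel
    rw [mul_assoc, h, mul_sub, hJJ, smul_mul_assoc, hN, mul_one, smul_smul, add_smul, one_smul,
      add_sub_cancel_right]
  refine ⟨?_, hJA⟩
  apply huA.mul_left_cancel
  rw [← mul_assoc, h, sub_mul, hJA, mul_sub, hA, one_mul, mul_one]

/-- The incidence matrix of a family of finite sets. -/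
def incMat {ι V : Type*} [DecidableEq V] (A : ι → Finset V) : Matrix ι V ℚ :=
  Matrix.of fun i v => if v ∈ A i then 1 else 0

theorem incMat_mul_transpose {ι κ : Type*} (A : ι → Finset V) (B : κ → Finset V) (i : ι) (j : κ) :
    (incMat A * (incMat B)ᵀ) i j = #(A i ∩ B j) := by
  simp [incMat, Matrix.mul_apply, Finset.inter_comm]

/-- If `A i` meets `B j` exactly when `i ≠ j`, then there are no more indices than points. -/
theorem card_le_of_crossing {ι : Type*} [Fintype ι] [DecidableEq ι] (A B : ι → Finset V)
    (h : ∀ i j, #(A i ∩ B j) = if i = j then 0 else 1) (h2 : 2 ≤ Fintype.card ι) :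
    Fintype.card ι ≤ Fintype.card V := by
  have hAB : incMat A * (incMat B)ᵀ = offDiagOnes ι := by
    ext i j
    rw [incMat_mul_transpose, h]
    by_cases hij : i = j <;> simp [offDiagOnes, hij]
  -- The product has full rank but factors through a space of dimension `|V|`.
  have hr := Matrix.rank_of_isUnit _ (isUnit_offDiagOnes h2)
  rw [← hAB] at hr
  rw [← hr]
  exact (Matrix.rank_mul_le_left _ _).trans (Matrix.rank_le_card_width _)

/-- Two families of sets, of sizes `α` and `ω`, indexed by a ground set with `α * ω + 1` points,
such that `A i` meets `B j` in one point if `i ≠ j` and is disjoint from it otherwise. -/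
structure IsCrossing (A B : V → Finset V) (α ω : ℕ) : Prop where
  card_left : ∀ i, #(A i) = α
  card_right : ∀ i, #(B i) = ω
  card_inter : ∀ i j, #(A i ∩ B j) = if i = j then 0 else 1
  card_eq : Fintype.card V = α * ω + 1
  left_pos : 1 ≤ α
  right_pos : 1 ≤ ω

/-! ### Crossing families: duality, uniqueness, partitions -/

namespace IsCrossing

variable {A B : V → Finset V} {α ω : ℕ}

theorem symm (h : IsCrossing A B α ω) : IsCrossing B A ω α where
  card_left := h.card_right
  card_right := h.card_left
  card_inter i j := by rw [Finset.inter_comm, h.card_inter]; simp only [eq_comm]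
  card_eq := by rw [h.card_eq, mul_comm]
  left_pos := h.right_pos
  right_pos := h.left_pos

theorem two_le (h : IsCrossing A B α ω) : 2 ≤ Fintype.card V := by
  have := h.card_eq
  have := Nat.mul_le_mul h.left_pos h.right_pos
  omega

theorem incMat_mul (h : IsCrossing A B α ω) : incMat A * (incMat B)ᵀ = offDiagOnes V := by
  ext i j
  rw [incMat_mul_transpose, h.card_inter]
  by_cases hij : i = j <;> simp [offDiagOnes, hij]

theorem matrix_identities (h : IsCrossing A B α ω) :
    (incMat B)ᵀ * incMat A = offDiagOnes V ∧
      Matrix.of (fun _ _ => (1 : ℚ)) * incMat A =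
        (α : ℚ) • (Matrix.of (fun _ _ => (1 : ℚ)) : Matrix V V ℚ) := by
  refine mul_comm_of_mul_eq_offDiagOnes (ω := ω) (by exact_mod_cast h.card_eq) h.two_le ?_ ?_
    h.incMat_mul
  · ext i j
    simp [incMat, Matrix.mul_apply, h.card_left]
  · ext i j
    simp [incMat, Matrix.mul_apply, h.card_right]

theorem card_left_mem (h : IsCrossing A B α ω) (v : V) : #{i | v ∈ A i} = α := by
  have := congrFun (congrFun h.matrix_identities.2 v) v
  simp [incMat, Matrix.mul_apply] at this
  exact_mod_cast this

/-- This is the commuted matrix product read entrywise: it exchanges the roles of indices and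
points. -/
theorem card_mem_mem (h : IsCrossing A B α ω) (u v : V) :
    #{i | u ∈ B i ∧ v ∈ A i} = if u = v then 0 else 1 := by
  have := congrFun (congrFun h.matrix_identities.1 u) v
  simp only [incMat, Matrix.mul_apply, Matrix.transpose_apply, Matrix.of_apply, offDiagOnes,
    ← ite_and, mul_ite, mul_one, mul_zero, Finset.sum_boole] at this
  have h' : #{i | v ∈ A i ∧ u ∈ B i} = if u = v then 0 else 1 := by
    by_cases huv : u = v <;> simp only [huv, if_true, if_false] at this ⊢ <;> exact_mod_cast this
  simpa only [and_comm] using h'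

theorem injective_left (h : IsCrossing A B α ω) : Function.Injective A := by
  intro i j hij
  have h1 := h.card_inter i j
  have h2 := h.card_inter j j
  rw [hij] at h1
  by_contra hne
  rw [if_neg hne] at h1
  rw [if_pos rfl] at h2
  omega

/-- Each point lies in `ω` of the `B i`, so the intersections sum to `αω = |V| - 1`, and all but the
`j`-th are `1`. Thus `T` and `A j` have the same intersection numbers with all `B i`, which
determine a set by invertibility. -/
theorem eq_left_of_disjoint (h : IsCrossing A B α ω) {T : Finset V} (hT : #T = α)
    (hle : ∀ i, #(T ∩ B i) ≤ 1) {j : V} (hj : #(T ∩ B j) = 0) : T = A j := by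
  have hsum : ∑ i, #(T ∩ B i) = α * ω := by
    have : ∀ i, #(T ∩ B i) = ∑ u ∈ T, if u ∈ B i then 1 else 0 := by
      intro i
      rw [Finset.sum_boole, Finset.filter_mem_eq_inter]; simp
    simp_rw [this]
    rw [Finset.sum_comm]
    simp_rw [Finset.sum_boole, h.symm.card_left_mem]
    simp [hT]
  have hone : ∀ i, i ≠ j → #(T ∩ B i) = 1 := by
    have h1 : ∑ i ∈ univ.erase j, #(T ∩ B i) = ∑ i ∈ univ.erase j, 1 := by
      have := Finset.add_sum_erase univ (fun i => #(T ∩ B i)) (Finset.mem_univ j)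
      have hc := h.card_eq
      simp only [Finset.sum_const, Finset.card_erase_of_mem (Finset.mem_univ j), Finset.card_univ,
        smul_eq_mul, mul_one]
      simp only [hj] at this
      omega
    intro i hi
    exact (Finset.sum_eq_sum_iff_of_le fun i _ => hle i).1 h1 i (by simp [hi])
  have hinj : Function.Injective fun x : Matrix Unit V ℚ => x * (incMat B)ᵀ := by
    intro x y hxy
    have hxy' : x * ((incMat B)ᵀ * incMat A) = y * ((incMat B)ᵀ * incMat A) := by
      rw [← Matrix.mul_assoc, ← Matrix.mul_assoc]
      exact congrArg (· * incMat A) hxy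
    rw [h.matrix_identities.1] at hxy'
    obtain ⟨u, hu⟩ := isUnit_offDiagOnes h.two_le
    rw [← hu] at hxy'
    have := congrArg (· * (↑u⁻¹ : Matrix V V ℚ)) hxy'
    simpa [Matrix.mul_assoc] using this
  have heq : incMat (fun _ : Unit => T) = incMat (fun _ : Unit => A j) := by
    apply hinj
    ext x i
    simp only [incMat_mul_transpose, h.card_inter]
    by_cases hi : i = j
    · subst hi; simp [hj]
    · simp [hone i hi, Ne.symm hi]
  ext v
  have := congrFun (congrFun heq ()) v
  by_cases h1 : v ∈ T <;> by_cases h2 : v ∈ A j <;> simp [incMat, h1, h2] at this ⊢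

theorem existsUnique_mem (h : IsCrossing A B α ω) {u v : V} (huv : u ≠ v) :
    ∃! i, v ∈ B i ∧ u ∈ A i := by
  have := h.card_mem_mem v u
  rw [if_neg huv.symm, Finset.card_eq_one] at this
  obtain ⟨i, hi⟩ := this
  simp only [Finset.ext_iff, Finset.mem_filter_univ, Finset.mem_singleton] at hi
  exact ⟨i, (hi i).2 rfl, fun j hj => (hi j).1 hj⟩

theorem not_mem_mem (h : IsCrossing A B α ω) {i v : V} (hB : v ∈ B i) : v ∉ A i := by
  intro hA
  have := h.card_inter i i
  simp only [if_true, Finset.card_eq_zero] at this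
  exact Finset.notMem_empty v (this ▸ Finset.mem_inter.2 ⟨hA, hB⟩)

theorem exists_finpartition (h : IsCrossing A B α ω) (v : V) :
    ∃ P : Finpartition (univ.erase v), #P.parts = ω ∧ ∀ K ∈ P.parts, ∃ i, K = A i := by
  refine ⟨Finpartition.ofExistsUnique (({i | v ∈ B i} : Finset V).image A) ?_ ?_ ?_, ?_, ?_⟩
  · intro K hK u hu
    obtain ⟨i, hi, rfl⟩ := Finset.mem_image.1 hK
    have hi : v ∈ B i := by simpa using hi
    have : u ≠ v := by rintro rfl; exact h.not_mem_mem hi hu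
    simpa using this
  · intro u hu
    obtain ⟨i, hi, huni⟩ := h.existsUnique_mem (Finset.ne_of_mem_erase hu)
    refine ⟨A i, ⟨Finset.mem_image_of_mem _ (by simpa using hi.1), hi.2⟩, ?_⟩
    rintro K ⟨hK, huK⟩
    obtain ⟨j, hj, rfl⟩ := Finset.mem_image.1 hK
    rw [huni j ⟨by simpa using hj, huK⟩]
  · intro he
    obtain ⟨i, -, hi⟩ := Finset.mem_image.1 he
    have := h.card_left i
    have := h.left_pos
    simp [hi] at *
    omega
  · rw [Finpartition.ofExistsUnique]
    simp only
    rw [Finset.card_image_of_injective _ h.injective_left, h.symm.card_left_mem]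
  · intro K hK
    obtain ⟨i, -, rfl⟩ := Finset.mem_image.1 hK
    exact ⟨i, rfl⟩

end IsCrossing

end SetSystem

/-! ### Minimal imperfect graphs: colourings and the crossing structure -/

namespace SimpleGraph

open Finset

variable {V : Type*} {G : SimpleGraph V}

theorem IsPerfect.colorable [Finite V] (h : G.IsPerfect) : G.Colorable G.cliqueNum := by
  have h1 := h Set.univ
  have h2 : (G.induce Set.univ).Colorable (G.induce Set.univ).cliqueNum :=
    chromaticNumber_le_iff_colorable.1 h1.le
  exact ((colorable_congr (induceUnivIso G)).1 h2).mono (cliqueNum_induce_le _)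

theorem IsMinimalImperfect.not_colorable [Finite V] (h : G.IsMinimalImperfect) :
    ¬ G.Colorable G.cliqueNum := by
  intro hc
  apply h.1
  intro s
  by_cases hs : s = Set.univ
  · subst hs
    refine le_antisymm ?_ cliqueNum_le_chromaticNumber
    rw [chromaticNumber_le_iff_colorable, colorable_congr (induceUnivIso G)]
    obtain ⟨t, ht⟩ := G.exists_isNClique_cliqueNum
    refine hc.mono ?_
    rw [← ht.card_eq, ← Finset.card_map (induceUnivIso G).symm.toEquiv.toEmbedding]
    refine IsClique.card_le_cliqueNum (tc := ?_)
    intro x hx y hy hxy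
    simp only [Finset.coe_map, Set.mem_image] at hx hy
    obtain ⟨x, hx, rfl⟩ := hx
    obtain ⟨y, hy, rfl⟩ := hy
    exact ht.isClique hx hy fun he => hxy (Subtype.ext he)
  · exact chromaticNumber_le_iff_colorable.2 (h.2 s hs).colorable |>.antisymm
      cliqueNum_le_chromaticNumber

/-- Proper induced subgraphs of a minimal imperfect graph have colourings with few colours. -/
theorem IsMinimalImperfect.exists_coloring [Finite V] (h : G.IsMinimalImperfect) {X : Set V}
    (hX : X ≠ Set.univ) {k : ℕ}
    (hk : ∀ Q : Finset V, (Q : Set V) ⊆ X → G.IsClique Q → #Q ≤ k) :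
    ∃ c : V → ℕ, (∀ x ∈ X, c x < k) ∧ ∀ x ∈ X, ∀ y ∈ X, G.Adj x y → c x ≠ c y := by
  classical
  have hcol : (G.induce X).Colorable k := by
    refine (h.2 X hX).colorable.mono ?_
    obtain ⟨t, ht⟩ := (G.induce X).exists_isNClique_cliqueNum
    rw [← ht.card_eq, ← Finset.card_map (Function.Embedding.subtype X)]
    apply hk
    · intro x hx
      simp only [Finset.coe_map, Set.mem_image] at hx
      obtain ⟨y, -, rfl⟩ := hx
      exact y.2
    · intro x hx y hy hxy
      simp only [Finset.coe_map, Set.mem_image] at hx hy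
      obtain ⟨x, hx, rfl⟩ := hx
      obtain ⟨y, hy, rfl⟩ := hy
      exact ht.isClique hx hy fun he => hxy (by rw [he])
  obtain ⟨c⟩ := hcol
  refine ⟨fun x => if hx : x ∈ X then c ⟨x, hx⟩ else 0, fun x hx => ?_, fun x hx y hy hxy => ?_⟩
  · simp [hx]
  · have : c ⟨x, hx⟩ ≠ c ⟨y, hy⟩ := c.valid hxy
    simpa [hx, hy, Fin.ext_iff] using this

theorem IsMinimalImperfect.nonempty [Finite V] (h : G.IsMinimalImperfect) : Nonempty V := by
  by_contra hV
  rw [not_nonempty_iff] at hV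
  exact h.not_colorable (.of_isEmpty _)

theorem one_le_cliqueNum [Finite V] [Nonempty V] (G : SimpleGraph V) : 1 ≤ G.cliqueNum := by
  inhabit V
  simpa using (IsClique.card_le_cliqueNum (G := G) (t := {default}) (tc := by simp))

theorem one_le_indepNum [Finite V] [Nonempty V] (G : SimpleGraph V) : 1 ≤ G.indepNum := by
  rw [← cliqueNum_compl]; exact one_le_cliqueNum _

/-- A stable set of a minimal imperfect graph misses some maximum clique. -/
theorem IsMinimalImperfect.exists_isNClique_disjoint [Finite V] (h : G.IsMinimalImperfect)
    {S : Finset V} (hS : G.IsIndepSet S) :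
    ∃ Q : Finset V, G.IsNClique G.cliqueNum Q ∧ Disjoint S Q := by
  classical
  have := h.nonempty
  by_contra! hno
  have hω := G.one_le_cliqueNum
  rcases S.eq_empty_or_nonempty with rfl | ⟨s, hs⟩
  · obtain ⟨Q, hQ⟩ := G.exists_isNClique_cliqueNum
    exact hno Q hQ (by simp)
  -- If `S` met every maximum clique, its complement would need only `ω - 1` colours, and `S` could
  -- serve as the last class.
  obtain ⟨c, hc, hc'⟩ := h.exists_coloring (X := (S : Set V)ᶜ) (k := G.cliqueNum - 1)
    (by
      intro he
      have : s ∈ (S : Set V)ᶜ := he ▸ Set.mem_univ s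
      exact this hs)
    (by
      intro Q hQ hcl
      have h1 : #Q ≤ G.cliqueNum := IsClique.card_le_cliqueNum (tc := hcl)
      by_contra! hlt
      refine hno Q ⟨hcl, by omega⟩ ?_
      rw [Finset.disjoint_left]
      exact fun x hx hxQ => hQ hxQ hx)
  apply h.not_colorable
  rw [colorable_iff_exists_bdd_nat_coloring]
  refine ⟨Coloring.mk (fun x => if x ∈ S then G.cliqueNum - 1 else c x) ?_, ?_⟩
  · intro x y hxy
    by_cases hx : x ∈ S <;> by_cases hy : y ∈ S
    · exact absurd hxy (hS hx hy hxy.ne)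
    · have := hc y (by simpa using hy)
      simp only [hx, hy, if_true, if_false]; omega
    · have := hc x (by simpa using hx)
      simp only [hx, hy, if_true, if_false]; omega
    · simpa only [hx, hy, if_false] using hc' x (by simpa using hx) y (by simpa using hy) hxy
  · intro x
    change (if x ∈ S then G.cliqueNum - 1 else c x) < _
    by_cases hx : x ∈ S
    · simp only [hx, if_true]; omega
    · have := hc x (by simpa using hx)
      simp only [hx, if_false]; omega

theorem IsClique.card_inter_le_one [DecidableEq V] {S Q : Finset V} (hQ : G.IsClique Q)
    (hS : G.IsIndepSet S) : #(S ∩ Q) ≤ 1 := by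
  rw [Finset.card_le_one]
  intro x hx y hy
  rw [Finset.mem_inter] at hx hy
  by_contra hxy
  exact hS hx.1 hy.1 hxy (hQ hx.2 hy.2 hxy)

/-- Vertex-deleted subgraphs of a minimal imperfect graph have `ω`-colourings. -/
theorem IsMinimalImperfect.exists_coloring_ne [Finite V] (h : G.IsMinimalImperfect) (v : V) :
    ∃ c : V → ℕ, (∀ x, x ≠ v → c x < G.cliqueNum) ∧
      ∀ x, x ≠ v → ∀ y, y ≠ v → G.Adj x y → c x ≠ c y :=
  h.exists_coloring (X := {x | x ≠ v})
    (fun he => (he ▸ Set.mem_univ v : v ∈ {x | x ≠ v}) rfl)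
    fun _ _ hQ => IsClique.card_le_cliqueNum (tc := hQ)

section Structure

variable [Fintype V] [DecidableEq V]

theorem isIndepSet_colorClass {v : V} {c : V → ℕ}
    (hc : ∀ x, x ≠ v → ∀ y, y ≠ v → G.Adj x y → c x ≠ c y) (k : ℕ) :
    G.IsIndepSet (({x | x ≠ v ∧ c x = k} : Finset V) : Set V) := by
  intro x hx y hy _ hadj
  simp only [Finset.coe_filter, Finset.mem_univ, true_and, Set.mem_ofPred_eq] at hx hy
  exact hc x hx.1 y hy.1 hadj (hx.2.trans hy.2.symm)

theorem sum_card_colorClass {v : V} {c : V → ℕ} {n : ℕ} (hc : ∀ x, x ≠ v → c x < n) :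
    ∑ k ∈ range n, #{x | x ≠ v ∧ c x = k} = Fintype.card V - 1 := by
  have := Finset.card_eq_sum_card_fiberwise (s := univ.erase v) (t := range n) (f := c)
    (by intro x hx; simpa using hc x (by simpa using hx))
  rw [Finset.card_erase_of_mem (Finset.mem_univ v), Finset.card_univ] at this
  rw [this]
  refine Finset.sum_congr rfl fun k _ => congrArg _ ?_
  ext x; simp

/-- If an `n`-clique `Q` misses a class of an `n`-colouring of `G - v`, then `Q` contains `v` and
misses no other class. -/
theorem IsNClique.mem_and_eq_of_disjoint_colorClass {v : V} {c : V → ℕ} {Q : Finset V} {n : ℕ}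
    (hQ : G.IsNClique n Q)
    (hlt : ∀ x, x ≠ v → c x < n)
    (hc : ∀ x, x ≠ v → ∀ y, y ≠ v → G.Adj x y → c x ≠ c y) {k : ℕ} (hk : k < n)
    (hd : Disjoint ({x | x ≠ v ∧ c x = k} : Finset V) Q) :
    v ∈ Q ∧ ∀ l < n, Disjoint ({x | x ≠ v ∧ c x = l} : Finset V) Q → l = k := by
  have hmiss : ∀ l, Disjoint ({x | x ≠ v ∧ c x = l} : Finset V) Q →
      ∀ x ∈ Q.erase v, c x ≠ l := by
    intro l hl x hx he
    rw [Finset.mem_erase] at hx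
    exact Finset.disjoint_left.1 hl (by simpa using ⟨hx.1, he⟩) hx.2
  have hinj : Set.InjOn c (Q.erase v) := by
    intro x hx y hy hxy
    rw [Finset.mem_coe, Finset.mem_erase] at hx hy
    by_contra hne
    exact hc x hx.1 y hy.1 (hQ.isClique hx.2 hy.2 hne) hxy
  -- `Q - v` injects into the `n - 1` colours other than `k`; so `v ∈ Q`, and then all these colours
  -- occur.
  have hsub : (Q.erase v).image c ⊆ (range n).erase k := by
    intro l hl
    obtain ⟨x, hx, rfl⟩ := Finset.mem_image.1 hl
    rw [Finset.mem_erase, Finset.mem_range]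
    exact ⟨hmiss k hd x hx, hlt x (Finset.ne_of_mem_erase hx)⟩
  have hle := Finset.card_le_card hsub
  rw [Finset.card_image_of_injOn hinj, Finset.card_erase_of_mem (Finset.mem_range.2 hk),
    Finset.card_range] at hle
  have hcard := hQ.card_eq
  have hv : v ∈ Q := by
    by_contra hv
    rw [Finset.erase_eq_of_notMem hv] at hle
    omega
  refine ⟨hv, fun l hl hdl => ?_⟩
  have heq : (Q.erase v).image c = (range n).erase k := by
    apply Finset.eq_of_subset_of_card_le hsub
    rw [Finset.card_image_of_injOn hinj, Finset.card_erase_of_mem (Finset.mem_range.2 hk),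
      Finset.card_range, Finset.card_erase_of_mem hv]
    omega
  by_contra hne
  have : l ∈ (Q.erase v).image c := by
    rw [heq, Finset.mem_erase, Finset.mem_range]; exact ⟨hne, hl⟩
  obtain ⟨x, hx, hxl⟩ := Finset.mem_image.1 this
  exact hmiss l hdl x hx hxl

/-- The crossing structure of maximum stable sets and maximum cliques in a minimal imperfect
graph, containing a prescribed maximum stable set. -/
theorem IsMinimalImperfect.exists_isCrossing (h : G.IsMinimalImperfect) {S : Finset V}
    (hS : G.IsNIndepSet G.indepNum S) :
    ∃ A B : V → Finset V, IsCrossing A B G.indepNum G.cliqueNum ∧ (∃ i, A i = S) ∧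
      (∀ i, G.IsNIndepSet G.indepNum (A i)) ∧ ∀ i, G.IsNClique G.cliqueNum (B i) := by
  have := h.nonempty
  have hω := G.one_le_cliqueNum
  have hα := G.one_le_indepNum
  choose c hlt hc using h.exists_coloring_ne
  -- `none` stands for `S` and `(s, k)` for class `k` of `G - s`: in all `αω + 1` stable sets.
  let ι := Option (S × Fin G.cliqueNum)
  let A : ι → Finset V := fun i =>
    i.elim S fun p => univ.filter fun x => x ≠ p.1.1 ∧ c p.1.1 x = p.2
  have hA : ∀ i, G.IsIndepSet (A i : Set V) := by
    rintro (_ | ⟨s, k⟩)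
    · exact hS.isIndepSet
    · exact isIndepSet_colorClass (hc s.1) k
  choose B hB hAB using fun i => h.exists_isNClique_disjoint (hA i)
  -- A maximum clique missing a class of `G - s` contains `s`. Hence it meets `S`, and two different
  -- vertices `s` cannot occur since `S` is stable.
  have huniq : ∀ (Q : Finset V), G.IsNClique G.cliqueNum Q → ∀ i j, Disjoint (A i) Q →
      Disjoint (A j) Q → i = j := by
    rintro Q hQ (_ | ⟨s, k⟩) (_ | ⟨t, l⟩) hi hj
    · rfl
    · exact absurd (hQ.mem_and_eq_of_disjoint_colorClass (hlt _) (hc _) l.2 hj).1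
        (Finset.disjoint_left.1 hi t.2)
    · exact absurd (hQ.mem_and_eq_of_disjoint_colorClass (hlt _) (hc _) k.2 hi).1
        (Finset.disjoint_left.1 hj s.2)
    · have hs := hQ.mem_and_eq_of_disjoint_colorClass (hlt _) (hc _) k.2 hi
      have ht := hQ.mem_and_eq_of_disjoint_colorClass (hlt _) (hc _) l.2 hj
      have hst : s = t := by
        by_contra hne
        have hne' : s.1 ≠ t.1 := fun he => hne (Subtype.ext he)
        exact hS.isIndepSet s.2 t.2 hne' (hQ.isClique hs.1 ht.1 hne')
      subst hst
      rw [Fin.ext (hs.2 l l.2 hj)]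
  have hinter : ∀ i j, #(A i ∩ B j) = if i = j then 0 else 1 := by
    intro i j
    by_cases hij : i = j
    · subst hij
      simpa [Finset.disjoint_iff_inter_eq_empty] using hAB i
    · rw [if_neg hij]
      have h1 := (hB j).isClique.card_inter_le_one (hA i)
      have h2 : #(A i ∩ B j) ≠ 0 := by
        intro h0
        rw [Finset.card_eq_zero, ← Finset.disjoint_iff_inter_eq_empty] at h0
        exact hij (huniq _ (hB j) i j h0 (hAB j))
      omega
  have hcardι : Fintype.card ι = G.indepNum * G.cliqueNum + 1 := by
    simp [ι, hS.card_eq]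
  have hαω := Nat.mul_le_mul hα hω
  have hle : Fintype.card ι ≤ Fintype.card V := card_le_of_crossing A B hinter (by omega)
  have hclass : ∀ v k, #{x | x ≠ v ∧ c v x = k} ≤ G.indepNum := fun v k =>
    IsIndepSet.card_le_indepNum (isIndepSet_colorClass (hc v) k)
  have hge : ∀ v : V, Fintype.card V - 1 ≤ G.indepNum * G.cliqueNum := by
    intro v
    rw [← sum_card_colorClass (hlt v)]
    refine (Finset.sum_le_sum fun k _ => hclass v k).trans ?_
    simp [mul_comm]
  have hcardV : Fintype.card V = G.indepNum * G.cliqueNum + 1 := by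
    have := hge (Classical.arbitrary V)
    omega
  -- The `ω` classes have at most `α` vertices each and cover `αω` vertices, so every bound is
  -- tight.
  have hclass_eq : ∀ v, ∀ k < G.cliqueNum, #{x | x ≠ v ∧ c v x = k} = G.indepNum := by
    intro v k hk
    have hsum : ∑ k ∈ range G.cliqueNum, #{x | x ≠ v ∧ c v x = k} =
        ∑ _k ∈ range G.cliqueNum, G.indepNum := by
      rw [sum_card_colorClass (hlt v), hcardV]
      simp [mul_comm]
    exact (Finset.sum_eq_sum_iff_of_le fun k _ => hclass v k).1 hsum k (Finset.mem_range.2 hk)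
  have hAcard : ∀ i, #(A i) = G.indepNum := by
    rintro (_ | ⟨s, k⟩)
    · exact hS.card_eq
    · exact hclass_eq s.1 k k.2
  let e : V ≃ ι := Fintype.equivOfCardEq (hcardV.trans hcardι.symm)
  refine ⟨A ∘ e, B ∘ e, ⟨fun i => hAcard _, fun i => (hB _).card_eq, fun i j => ?_, hcardV, hα, hω⟩,
    ⟨e.symm none, by simp [A]⟩, fun i => ⟨hA _, hAcard _⟩, fun i => hB _⟩
  simp [hinter]

end Structure

end SimpleGraph

/-! ### Odd pairs of cliques: parity, exchange, cliques of the join -/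

namespace SimpleGraph

open Finset

variable {V : Type*} {G : SimpleGraph V}

/-- The spanning subgraph whose edges are the edges of `G` with both ends in `X`. -/
def edgesWithin (G : SimpleGraph V) (X : Set V) : SimpleGraph V where
  Adj x y := G.Adj x y ∧ x ∈ X ∧ y ∈ X
  symm := ⟨fun _ _ h => ⟨h.1.symm, h.2.2, h.2.1⟩⟩
  loopless := ⟨fun _ h => h.1.ne rfl⟩

theorem edgesWithin_le (G : SimpleGraph V) (X : Set V) : G.edgesWithin X ≤ G := fun _ _ h => h.1

theorem mem_of_mem_support_edgesWithin {X : Set V} {u v : V} (p : (G.edgesWithin X).Walk u v)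
    (hu : u ∈ X) {x : V} (hx : x ∈ p.support) : x ∈ X := by
  induction p with
  | nil => rw [Walk.support_nil, List.mem_singleton] at hx; rwa [hx]
  | cons h p ih =>
    rw [Walk.support_cons, List.mem_cons] at hx
    rcases hx with rfl | hx
    · exact hu
    · exact ih h.2.2 hx

/-- A chord would be a shortcut. -/
theorem Walk.isChordless_of_length_eq_dist {u v : V} (p : G.Walk u v)
    (hp : p.length = G.dist u v) : p.IsChordless := by
  have key : ∀ i j, i < j → j ≤ p.length → G.Adj (p.getVert i) (p.getVert j) →
      s(p.getVert i, p.getVert j) ∈ p.edges := by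
    intro i j hij hj hadj
    have hlen := G.dist_le ((p.take i).append (Walk.cons hadj (p.drop j)))
    rw [Walk.length_append, Walk.length_cons, Walk.take_length, Walk.drop_length] at hlen
    have : j = i + 1 := by omega
    subst this
    rw [Walk.edges, List.mem_map]
    exact ⟨p.darts[i]'(by simpa using hj), List.getElem_mem _, by
      rw [Walk.darts_getElem_eq_getVert]; rfl⟩
  rw [Walk.isChordless_iff_forall_mem_edges]
  intro x y hx hy hadj
  rw [Walk.mem_support_iff_exists_getVert] at hx hy
  obtain ⟨i, rfl, hi⟩ := hx
  obtain ⟨j, rfl, hj⟩ := hy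
  rcases lt_trichotomy i j with h | h | h
  · exact key i j h hj hadj
  · subst h; exact absurd rfl hadj.ne
  · rw [Sym2.eq_swap]; exact key j i h hi hadj.symm

/-- Connected vertices of an induced subgraph are joined by an induced path inside it. -/
theorem exists_isChordless_of_reachable {X : Set V} {a b : V} (ha : a ∈ X)
    (h : (G.edgesWithin X).Reachable a b) :
    ∃ p : (G.edgesWithin X).Walk a b, (p.mapLe (G.edgesWithin_le X)).IsPath ∧
      (p.mapLe (G.edgesWithin_le X)).IsChordless := by
  obtain ⟨p, hp⟩ := h.exists_walk_length_eq_dist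
  refine ⟨p, (Walk.isPath_mapLe _).2 (p.isPath_of_length_eq_dist hp), ?_⟩
  rw [Walk.isChordless_iff_forall_mem_edges]
  intro x y hx hy hadj
  rw [Walk.support_mapLe_eq_support] at hx hy
  rw [Walk.edges_mapLe_eq_edges]
  exact (p.isChordless_of_length_eq_dist hp).mem_edges hx hy
    ⟨hadj, mem_of_mem_support_edgesWithin p ha hx, mem_of_mem_support_edgesWithin p ha hy⟩

theorem IsIndepSet.eq_of_mem_isClique {S K : Set V} (hS : G.IsIndepSet S) (hK : G.IsClique K)
    {x y : V} (hxS : x ∈ S) (hyS : y ∈ S) (hxK : x ∈ K) (hyK : y ∈ K) : x = y := by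
  by_contra hne
  exact hS hxS hyS hne (hK hxK hyK hne)

/-- Two vertices of a stable set `S`, in the two cliques of an odd pair, lie in different
components of the graph induced by `S ∪ T` if `T` is a stable set missing both cliques. -/
theorem IsOddPairOfCliques.not_reachable {K₁ K₂ : Finset V} (hK : G.IsOddPairOfCliques K₁ K₂)
    {S T : Set V} (hS : G.IsIndepSet S) (hT : G.IsIndepSet T)
    (hT₁ : ∀ x ∈ T, x ∉ K₁) (hT₂ : ∀ x ∈ T, x ∉ K₂) {a b : V} (ha : a ∈ S) (hb : b ∈ S)
    (ha₁ : a ∈ K₁) (hb₂ : b ∈ K₂) : ¬ (G.edgesWithin (S ∪ T)).Reachable a b := by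
  classical
  intro hr
  obtain ⟨p, hpath, hchord⟩ := exists_isChordless_of_reachable (X := S ∪ T) (Or.inl ha) hr
  have hodd := hK.2.2 a b _ ⟨hpath, hchord, ha₁, hb₂, by
    intro x hx hxa hxb
    rw [Walk.support_mapLe_eq_support] at hx
    rcases mem_of_mem_support_edgesWithin p (Or.inl ha) hx with hxS | hxT
    · exact ⟨fun h => hxa (hS.eq_of_mem_isClique hK.1 hxS ha h ha₁),
        fun h => hxb (hS.eq_of_mem_isClique hK.2.1 hxS hb h hb₂)⟩
    · exact ⟨hT₁ x hxT, hT₂ x hxT⟩⟩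
  rw [Walk.length_mapLe] at hodd
  -- Membership in `S` is a 2-colouring giving `a` and `b` the same colour, so the path is even.
  let c : (G.edgesWithin (S ∪ T)).Coloring Bool := Coloring.mk (fun x => decide (x ∈ S)) (by
    rintro x y ⟨hadj, hx, hy⟩ he
    rw [decide_eq_decide] at he
    by_cases hxS : x ∈ S
    · exact hS hxS (he.1 hxS) hadj.ne hadj
    · exact hT (hx.resolve_left hxS) (hy.resolve_left fun h => hxS (he.2 h)) hadj.ne hadj)
  have heven : Even p.length := by
    rw [c.even_length_iff_congr p]
    change decide (a ∈ S) = true ↔ decide (b ∈ S) = true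
    simp [ha, hb]
  exact Nat.not_even_iff_odd.2 hodd heven

/-- Exchanging two stable sets on a union of components keeps them stable. -/
theorem IsIndepSet.exchange {S T C : Set V} (hS : G.IsIndepSet S) (hT : G.IsIndepSet T)
    (hC : ∀ x y, (G.edgesWithin (S ∪ T)).Adj x y → x ∈ C → y ∈ C) :
    G.IsIndepSet (S \ C ∪ T ∩ C) := by
  rintro x (hx | hx) y (hy | hy) hne hadj
  · exact hS hx.1 hy.1 hne hadj
  · exact hx.2 (hC y x ⟨hadj.symm, Or.inr hy.1, Or.inl hx.1⟩ hy.2)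
  · exact hy.2 (hC x y ⟨hadj, Or.inr hx.1, Or.inl hy.1⟩ hx.2)
  · exact hT hx.1 hy.1 hne hadj

theorem joinCliques_adj {K₁ K₂ : Finset V} {x y : V} :
    (G.joinCliques K₁ K₂).Adj x y ↔
      G.Adj x y ∨ x ≠ y ∧ (x ∈ K₁ ∧ y ∈ K₂ ∨ y ∈ K₁ ∧ x ∈ K₂) := by
  simp [joinCliques]

theorem le_joinCliques (K₁ K₂ : Finset V) : G ≤ G.joinCliques K₁ K₂ := le_sup_left

/-- A common neighbour of two nonadjacent vertices of an odd pair of cliques is in a clique. -/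
theorem IsOddPairOfCliques.adj_of_common_neighbor {K₁ K₂ : Finset V}
    (hK : G.IsOddPairOfCliques K₁ K₂) {a b v : V} (ha : a ∈ K₁) (hb : b ∈ K₂) (hne : a ≠ b)
    (hv₁ : v ∉ K₁) (hv₂ : v ∉ K₂) (hav : G.Adj a v) (hvb : G.Adj v b) : G.Adj a b := by
  by_contra hnadj
  have := hK.2.2 a b (Walk.cons hav (Walk.cons hvb Walk.nil)) ⟨?_, ?_, ha, hb, ?_⟩
  · exact absurd this (by simp)
  · simp [Walk.cons_isPath_iff, hav.ne, hvb.ne, hne]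
  · rw [Walk.isChordless_iff_forall_mem_edges]
    intro x y hx hy hxy
    simp only [Walk.support_cons, Walk.support_nil, List.mem_cons, List.not_mem_nil,
      or_false] at hx hy
    rcases hx with rfl | rfl | rfl <;> rcases hy with rfl | rfl | rfl <;>
      simp_all [G.adj_comm]
  · intro x hx hxa hxb
    simp only [Walk.support_cons, Walk.support_nil, List.mem_cons, List.not_mem_nil,
      or_false, hxa, hxb, false_or] at hx
    subst hx
    exact ⟨hv₁, hv₂⟩

/-- By size, `K` has a vertex `v` outside both cliques. Joining adds no edge at `v`, so `v` is a
common neighbour in `G` of the ends of any putative new edge. -/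
theorem IsOddPairOfCliques.isNClique_of_joinCliques [DecidableEq V] {K₁ K₂ : Finset V}
    (hK : G.IsOddPairOfCliques K₁ K₂) {n : ℕ} (hn : #K₁ + #K₂ < n) {K : Finset V}
    (h : (G.joinCliques K₁ K₂).IsNClique n K) : G.IsNClique n K := by
  obtain ⟨v, hvK, hv⟩ : ∃ v ∈ K, v ∉ K₁ ∪ K₂ := by
    apply Finset.exists_mem_notMem_of_card_lt_card
    rw [h.card_eq]
    exact (Finset.card_union_le _ _).trans_lt hn
  rw [Finset.mem_union, not_or] at hv
  have hadjv : ∀ x ∈ K, x ≠ v → G.Adj x v := by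
    intro x hx hxv
    rcases joinCliques_adj.1 (h.isClique hx hvK hxv) with h' | h'
    · exact h'
    · tauto
  have key : ∀ a ∈ K, ∀ b ∈ K, a ≠ b → a ∈ K₁ → b ∈ K₂ → G.Adj a b := by
    intro a ha b hb hne ha₁ hb₂
    have hav : a ≠ v := by rintro rfl; exact hv.1 ha₁
    have hbv : b ≠ v := by rintro rfl; exact hv.2 hb₂
    exact hK.adj_of_common_neighbor ha₁ hb₂ hne hv.1 hv.2 (hadjv a ha hav) (hadjv b hb hbv).symm
  refine ⟨fun x hx y hy hxy => ?_, h.card_eq⟩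
  rcases joinCliques_adj.1 (h.isClique hx hy hxy) with h' | ⟨-, ⟨h1, h2⟩ | ⟨h1, h2⟩⟩
  · exact h'
  · exact key x hx y hy hxy h1 h2
  · exact (key y hy x hx hxy.symm h1 h2).symm

/-! ### Maximum stable sets and the odd pair -/

section Main

variable [Fintype V] [DecidableEq V]

/-- No maximum stable set of a minimal imperfect graph meets both cliques of a small odd pair. -/
theorem IsMinimalImperfect.not_mem_of_oddPair (hG : G.IsMinimalImperfect) {K₁ K₂ : Finset V}
    (hK : G.IsOddPairOfCliques K₁ K₂) (hlt : #K₁ + #K₂ < G.cliqueNum) {S : Finset V}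
    (hS : G.IsNIndepSet G.indepNum S) {a b : V} (ha : a ∈ S) (hb : b ∈ S) (ha₁ : a ∈ K₁)
    (hb₂ : b ∈ K₂) : False := by
  classical
  obtain ⟨A, B, h, ⟨i, rfl⟩, hA, hB⟩ := hG.exists_isCrossing hS
  obtain ⟨v, hv⟩ : (B i).Nonempty := by
    rw [← Finset.card_pos, h.card_right]; exact h.right_pos
  -- The `ω` sets `A j` with `v ∈ B j` are pairwise disjoint, and `K₁ ∪ K₂` has too few vertices to
  -- meet them all.
  obtain ⟨j, hvj, hj⟩ : ∃ j, v ∈ B j ∧ Disjoint (A j) (K₁ ∪ K₂) := by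
    by_contra! hno
    have hno' : ∀ j, v ∈ B j → ∃ x ∈ A j, x ∈ K₁ ∪ K₂ := fun j hj =>
      Finset.not_disjoint_iff.1 (hno j hj)
    choose! f hf hf' using hno'
    have hle : #({j | v ∈ B j} : Finset V) ≤ #(K₁ ∪ K₂) := by
      refine Finset.card_le_card_of_injOn f (fun j hj => hf' j (by simpa using hj)) ?_
      intro j hj k hk hjk
      have hj : v ∈ B j := by simpa using hj
      have hk : v ∈ B k := by simpa using hk
      have hne : f j ≠ v := fun he => h.not_mem_mem hj (he ▸ hf j hj)
      exact (h.existsUnique_mem hne).unique ⟨hj, hf j hj⟩ ⟨hk, hjk ▸ hf k hk⟩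
    rw [h.symm.card_left_mem] at hle
    have := Finset.card_union_le K₁ K₂
    omega
  have hdisj : Disjoint (A i) (A j) := by
    rw [Finset.disjoint_left]
    intro x hxi hxj
    have hne : x ≠ v := fun he => h.not_mem_mem hv (he ▸ hxi)
    have hij := (h.existsUnique_mem hne).unique ⟨hv, hxi⟩ ⟨hvj, hxj⟩
    subst hij
    exact Finset.disjoint_left.1 hj ha (Finset.mem_union_left _ ha₁)
  have hj' : ∀ x ∈ A j, x ∉ K₁ ∧ x ∉ K₂ := fun x hx => by
    simpa [not_or] using Finset.disjoint_left.1 hj hx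
  have hnr := hK.not_reachable (hA i).isIndepSet (hA j).isIndepSet (fun x hx => (hj' x hx).1)
    (fun x hx => (hj' x hx).2) ha hb ha₁ hb₂
  set H := G.edgesWithin ((A i : Set V) ∪ A j) with hH
  let C : Finset V := {x | H.Reachable a x}
  have hC : ∀ x y, H.Adj x y → x ∈ (C : Set V) → y ∈ (C : Set V) := by
    intro x y hxy hx
    simp only [C, Finset.coe_filter, Finset.mem_univ, true_and, Set.mem_ofPred_eq] at hx ⊢
    exact hx.trans hxy.reachable
  have haC : a ∈ C := by simp [C]
  have hbC : b ∉ C := by simpa [C] using hnr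
  set S' := (A i \ C) ∪ (A j ∩ C) with hS'
  set T' := (A j \ C) ∪ (A i ∩ C) with hT'
  have hS'i : G.IsIndepSet (S' : Set V) := by
    have := (hA i).isIndepSet.exchange (hA j).isIndepSet hC
    simpa [hS'] using this
  have hT'i : G.IsIndepSet (T' : Set V) := by
    have := (hA j).isIndepSet.exchange (C := C) (hA i).isIndepSet (by rwa [Set.union_comm])
    simpa [hT'] using this
  -- With `X = univ` this forces both new sets to have size `α`; with `X = B i` the total is at most
  -- `1`, so one of them misses `B i`.
  have hsplit : ∀ X : Finset V, #(S' ∩ X) + #(T' ∩ X) = #(A i ∩ X) + #(A j ∩ X) := by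
    intro X
    have hd : Disjoint (S' ∩ X) (T' ∩ X) := by
      rw [Finset.disjoint_left] at hdisj ⊢
      intro x hx hx'
      simp only [hS', hT', Finset.mem_inter, Finset.mem_union, Finset.mem_sdiff] at hx hx'
      have := @hdisj x
      tauto
    rw [← Finset.card_union_of_disjoint hd, ← Finset.card_union_of_disjoint
      (hdisj.mono Finset.inter_subset_left Finset.inter_subset_left)]
    congr 1
    ext x
    simp only [hS', hT', Finset.mem_inter, Finset.mem_union, Finset.mem_sdiff]
    tauto
  have hcard := hsplit univ
  simp only [Finset.inter_univ, h.card_left] at hcard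
  have hS'le := hS'i.card_le_indepNum
  have hT'le := hT'i.card_le_indepNum
  have hmeet := hsplit (B i)
  have hi0 : #(A i ∩ B i) = 0 := by simpa using h.card_inter i i
  have hj1 := (hB i).isClique.card_inter_le_one (hA j).isIndepSet
  have hcase : #(S' ∩ B i) = 0 ∨ #(T' ∩ B i) = 0 := by omega
  rcases hcase with h0 | h0
  · have heq := h.eq_left_of_disjoint (by omega)
      (fun k => (hB k).isClique.card_inter_le_one hS'i) h0
    have : a ∉ S' := by
      have := Finset.disjoint_left.1 hdisj ha
      simp [hS', haC, this]
    exact this (heq ▸ ha)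
  · have heq := h.eq_left_of_disjoint (by omega)
      (fun k => (hB k).isClique.card_inter_le_one hT'i) h0
    have : b ∉ T' := by
      have := Finset.disjoint_left.1 hdisj hb
      simp [hT', hbC, this]
    exact this (heq ▸ hb)

theorem IsMinimalImperfect.isNIndepSet_joinCliques (hG : G.IsMinimalImperfect) {K₁ K₂ : Finset V}
    (hK : G.IsOddPairOfCliques K₁ K₂) (hlt : #K₁ + #K₂ < G.cliqueNum) {S : Finset V}
    (hS : G.IsNIndepSet G.indepNum S) : (G.joinCliques K₁ K₂).IsNIndepSet G.indepNum S := by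
  refine ⟨fun x hx y hy hxy hadj => ?_, hS.card_eq⟩
  rcases joinCliques_adj.1 hadj with h | ⟨-, ⟨h1, h2⟩ | ⟨h1, h2⟩⟩
  · exact hS.isIndepSet hx hy hxy h
  · exact hG.not_mem_of_oddPair hK hlt hS hx hy h1 h2
  · exact hG.not_mem_of_oddPair hK hlt hS hy hx h1 h2

end Main

end SimpleGraph

theorem mainTheorem5 {V : Type*} [Fintype V] [DecidableEq V] (G : SimpleGraph V)
    (hG : G.IsMinimalImperfect) (K₁ K₂ : Finset V) (hK : G.IsOddPairOfCliques K₁ K₂)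
    (hlt : K₁.card + K₂.card < G.cliqueNum) :
    (∀ K : Finset V, (G.joinCliques K₁ K₂).IsNClique G.cliqueNum K →
      G.IsNClique G.cliqueNum K) ∧
    (∀ S : Finset V, G.IsNIndepSet G.indepNum S →
      (G.joinCliques K₁ K₂).IsNIndepSet G.indepNum S) ∧
    (G.joinCliques K₁ K₂).IsPartitionable G.indepNum G.cliqueNum := by
  have hindep : ∀ S : Finset V, G.IsNIndepSet G.indepNum S →
      (G.joinCliques K₁ K₂).IsNIndepSet G.indepNum S :=
    fun S hS => hG.isNIndepSet_joinCliques hK hlt hS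
  refine ⟨fun K h => hK.isNClique_of_joinCliques hlt h, hindep, ?_⟩
  obtain ⟨S, hS⟩ := G.exists_isNIndepSet_indepNum
  obtain ⟨A, B, h, -, hA, hB⟩ := hG.exists_isCrossing hS
  refine ⟨h.left_pos, h.right_pos, fun v => ⟨?_, ?_⟩⟩
  -- The cliques `B i` remain cliques when edges are added; only the stable sets need claim 2.
  · obtain ⟨P, hP, hPB⟩ := h.symm.exists_finpartition v
    refine ⟨P, hP, fun K hKP => ?_⟩
    obtain ⟨i, rfl⟩ := hPB K hKP
    exact (hB i).mono (G.le_joinCliques K₁ K₂)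
  · obtain ⟨P, hP, hPA⟩ := h.exists_finpartition v
    refine ⟨P, hP, fun K hKP => ?_⟩
    obtain ⟨i, rfl⟩ := hPA K hKP
    exact hindep _ (hA i)
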